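/- Let $\rho,\mu:[0,+\infty)\to(0,+\infty)$ and put $a(y)=(\rho(y),\mu(y))$. For a vector $(r,m)$ with positive coordinates write $\operatorname{Arg}(r,m)=\arctan(m/r)$. Assume: (1) (Lipschitz continuity) $a$ is Lipschitz continuous on $[0,+\infty)$ and $a(y)\to a_\infty=(\rho_\infty,\mu_\infty)$ as $y\to+\infty$, where $\rho_\infty>0$ and $\mu_\infty>0$; (2) (integral boundedness) $\int_0^{\infty}|a(y)-a_\infty|\,dy<\infty$; (3) (monotonicity at infinity) there is an interval $(\bar y,+\infty)\subset[0,+\infty)$ on which either $\operatorname{Arg}a(y)<\operatorname{Arg}a_\infty$ everywhere, or $\operatorname{Arg}a(y)>\operatorname{Arg}a_\infty$ everywhere; (4) $\operatorname{Arg}a(y)<\operatorname{Arg}a_\infty$ for all $y$ in some subinterval of $[0,+\infty)$ of positive length. For $K,\Omega>0$ consider the boundary value problem on $[0,+\infty)$ $$(\mu(y)u'(y))'+(\Omega\rho(y)-K\mu(y))\,u(y)=0,\qquad u'(0)=0,\qquad \lim_{y\to+\infty}u(y)=0,$$ where a solution means a real function $u\not\equiv0$, differentiable on $[0,+\infty)$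 (one-sidedly at $0$), such that $\mu u'$ is differentiable and the equation holds at every point. Then the function $\mu/\rho$ attains its minimum over $[0,+\infty)$; let $\check\mu/\check\rho$ denote this minimum. For every $N\in\mathbb N$ there is $K_N>0$ such that for every $K>K_N$ there are at least $N$ distinct values $\Omega_j\in\left(\frac{\check\mu}{\check\rho}K,\ \frac{\mu_\infty}{\rho_\infty}K\right)$ for which the boundary value problem with parameters $(K,\Omega_j)$ has a solution. Consequently, if $N(k)\in\{0,1,2,\dots\}\cup\{\infty\}$ denotes the number of frequencies $\omega>0$ for which the boundary value problem with $K=k^2$, $\Omega=\omega^2$ has a solution (the number of surface waves with wave number $k$), then $N(k)\to\infty$ as $k\to+\infty$. -/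

import Mathlib

open Set Filter Topology MeasureTheory

noncomputable section

/-- The polar angle `Arctan (m / r)` of a vector `(r, m)` of the plane whose two coordinates
are positive. -/
def polarArg (r m : ℝ) : ℝ := Real.arctan (m / r)

/-- The density `ρ` and the shear modulus `μ` are positive on the half-line `[0, ∞)`. -/
def MediumPositive (ρ μ : ℝ → ℝ) : Prop :=
  ∀ y ∈ Ici (0 : ℝ), 0 < ρ y ∧ 0 < μ y

/-- Lipschitz continuity: `a = (ρ, μ)` is Lipschitz continuous on `[0, ∞)` and has the limit
`(ρinf, μinf)` at infinity, with positive coordinates. -/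
structure MediumLipschitz (ρ μ : ℝ → ℝ) (ρinf μinf : ℝ) : Prop where
  lipschitz : ∃ C, LipschitzOnWith C (fun y => (ρ y, μ y)) (Ici (0 : ℝ))
  tendsto : Tendsto (fun y => (ρ y, μ y)) atTop (𝓝 (ρinf, μinf))
  rho_pos : 0 < ρinf
  mu_pos : 0 < μinf

/-- Integral boundedness: the deviation of `a = (ρ, μ)` from its limit is integrable
on `[0, ∞)`. -/
def MediumIntegrable (ρ μ : ℝ → ℝ) (ρinf μinf : ℝ) : Prop :=
  IntegrableOn (fun y => (ρ y - ρinf, μ y - μinf)) (Ici (0 : ℝ)) volume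

/-- Monotonicity at infinity: on some interval `(b, ∞)` either the polar angle of
`(ρ y, μ y)` is everywhere smaller, or it is everywhere larger, than that of the limit. -/
def MediumMonotoneAtInfinity (ρ μ : ℝ → ℝ) (ρinf μinf : ℝ) : Prop :=
  ∃ b : ℝ, 0 ≤ b ∧
    ((∀ y ∈ Ioi b, polarArg (ρ y) (μ y) < polarArg ρinf μinf) ∨
     (∀ y ∈ Ioi b, polarArg ρinf μinf < polarArg (ρ y) (μ y)))

/-- `u` is a nontrivial classical solution on `[0, ∞)` of
`(μ u')' + (Ω ρ - K μ) u = 0` with `u' 0 = 0` and `u y → 0` as `y → ∞`. Derivatives at `0` are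
one-sided; since `μ` need not be differentiable, it is `μ u'` that is differentiated. -/
structure IsSurfaceWave (ρ μ : ℝ → ℝ) (K Ω : ℝ) (u : ℝ → ℝ) : Prop where
  differentiable : DifferentiableOn ℝ u (Ici 0)
  equation : ∀ y ∈ Ici (0 : ℝ),
    HasDerivWithinAt (fun s => μ s * derivWithin u (Ici 0) s)
      (-((Ω * ρ y - K * μ y) * u y)) (Ici 0) y
  traction_free : derivWithin u (Ici 0) 0 = 0
  decay : Tendsto u atTop (𝓝 0)
  nontrivial : ∃ y ∈ Ici (0 : ℝ), u y ≠ 0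

/-- The number (possibly infinite) of surface waves with wave number `k`: the number of
frequencies `ω > 0` for which the boundary value problem with `K = k ^ 2`, `Ω = ω ^ 2` has a
nontrivial solution. -/
def surfaceWaveCount (ρ μ : ℝ → ℝ) (k : ℝ) : ℕ∞ :=
  {ω : ℝ | 0 < ω ∧ ∃ u : ℝ → ℝ, IsSurfaceWave ρ μ (k ^ 2) (ω ^ 2) u}.encard

end

/-!
A solution `(u, v) = (u, μ u')` of `u' = v / μ`, `v' = -(Ω ρ - K μ) u` is written in polar form
`u = r sin θ`, `v = r cos θ`. The Prüfer angle then solves the scalar equation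
`θ' = cos² θ / μ + (Ω ρ - K μ) sin² θ`, whose right-hand side is bounded and Lipschitz, so that `θ`
exists globally, with `θ 0 = π / 2`, and depends continuously on `Ω`.

The eigenvalues are found by shooting in `Ω`. The angle can cross a multiple of `π` only upwards;
so "passing `n π`" is an open condition on `Ω`. It fails at `Ω = 0`, where the angle never leaves
`[0, π / 2]`. It holds at `Ω = b K`, for a `b` below `lim (μ / ρ)` but above some value of `μ / ρ`,
if `K` is large: near that value the coefficient of `sin² θ` is of order `K` and the angle rotates
fast (`exists_forall_isPrueferAngle_gt`, by dominated convergence of the passage time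
`∫ dx / (m cos² x + A sin² x)`). At the infimum of the parameters that pass `n π` the angle is
eventually trapped in `[n π - π / 2, n π]` (`IsPrueferFamily.exists_trapped`): since
`Ω ρ - K μ` is negative near infinity, an angle below `n π - π / 2` would remain there, for nearby
`Ω` as well. In this sector `u` and `μ u'` have opposite signs, so `|u|` decreases, and it is
integrable because `v' = (K μ - Ω ρ) u` and `v` is bounded; hence `u → 0`
(`IsPrueferAngle.tendsto_mul_sin`). Different `n` give different `Ω`, and `Ω > K min (μ / ρ)` for
`n ≥ 2` because for smaller `Ω` the angle stays below `π / 2`.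
-/

/-! ### Global solutions of scalar differential equations -/

/-- A scalar field that is bounded, continuous in time and uniformly Lipschitz in space has a
solution on the whole line through every initial value. -/
theorem exists_global_solution {F : ℝ → ℝ → ℝ} {L : NNReal} {B : ℝ}
    (hlip : ∀ t, LipschitzWith L (F t)) (hcont : ∀ x, Continuous fun t => F t x)
    (hbound : ∀ t x, |F t x| ≤ B) (x₀ : ℝ) :
    ∃ θ : ℝ → ℝ, θ 0 = x₀ ∧ ∀ t, HasDerivAt θ (F t (θ t)) t := by
  have hB : 0 ≤ B := (abs_nonneg _).trans (hbound 0 0)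
  have hloc : ∀ n : ℕ, ∃ α : ℝ → ℝ, α 0 = x₀ ∧
      ∀ t ∈ Ioo (-((n : ℝ) + 1)) ((n : ℝ) + 1), HasDerivAt α (F t (α t)) t := by
    intro n
    have hn : (0 : ℝ) ≤ (n : ℝ) + 1 := by positivity
    have h0 : (0 : ℝ) ∈ Icc (-((n : ℝ) + 1)) ((n : ℝ) + 1) := ⟨by linarith, hn⟩
    have hpl : IsPicardLindelof F ⟨0, h0⟩ x₀
        ((B * ((n : ℝ) + 1)).toNNReal) 0 B.toNNReal L := by
      refine ⟨fun t _ => (hlip t).lipschitzOnWith, fun x _ => (hcont x).continuousOn,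
        fun t _ x _ => ?_, ?_⟩
      · rw [Real.coe_toNNReal _ hB]; exact hbound t x
      · rw [Real.coe_toNNReal _ hB, Real.coe_toNNReal _ (by positivity)]
        simp
    obtain ⟨α, hα0, hα⟩ := hpl.exists_eq_forall_mem_Icc_hasDerivWithinAt₀
    exact ⟨α, hα0, fun t ht => (hα t (Ioo_subset_Icc_self ht)).hasDerivAt
      (Icc_mem_nhds ht.1 ht.2)⟩
  choose α hα0 hα using hloc
  have hagree : ∀ m n : ℕ, m ≤ n → EqOn (α m) (α n) (Ioo (-((m : ℝ) + 1)) ((m : ℝ) + 1)) := by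
    intro m n hmn
    have hmn' : (m : ℝ) ≤ n := by exact_mod_cast hmn
    have hm : (0 : ℝ) ≤ m := by positivity
    refine ODE_solution_unique_of_mem_Ioo (K := L) (v := F) (s := fun _ => univ) (t₀ := 0)
      (fun t _ => (hlip t).lipschitzOnWith) ⟨by linarith, by linarith⟩
      (fun t ht => ⟨hα m t ht, mem_univ _⟩)
      (fun t ht => ⟨hα n t ⟨by linarith [ht.1], by linarith [ht.2]⟩, mem_univ _⟩) ?_
    rw [hα0, hα0]
  refine ⟨fun t => α ⌈|t|⌉₊ t, hα0 _, fun t => ?_⟩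
  obtain ⟨n, hn⟩ := exists_nat_gt |t|
  have hmem : Ioo (-(n : ℝ)) n ∈ 𝓝 t := Ioo_mem_nhds (abs_lt.1 hn).1 (abs_lt.1 hn).2
  have heq : ∀ s ∈ Ioo (-(n : ℝ)) n, α ⌈|s|⌉₊ s = α n s := by
    intro s hs
    have hs' : |s| < (⌈|s|⌉₊ : ℝ) + 1 := by linarith [Nat.le_ceil |s|]
    exact hagree _ _ (Nat.ceil_le.2 (abs_lt.2 hs).le) ⟨(abs_lt.1 hs').1, (abs_lt.1 hs').2⟩
  have ht := abs_lt.1 hn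
  have hd := hα n t ⟨by linarith [ht.1], by linarith [ht.2]⟩
  rw [← heq t ⟨ht.1, ht.2⟩] at hd
  exact hd.congr_of_eventuallyEq (by filter_upwards [hmem] with s hs using heq s hs)

/-- A level that a differentiable function can only cross upwards remains below it. -/
theorem le_of_hasDerivAt_pos_on_level {f f' : ℝ → ℝ} {a c : ℝ}
    (hf : ∀ t, HasDerivAt f (f' t) t) (ha : c ≤ f a)
    (hlevel : ∀ t, a ≤ t → f t = c → 0 < f' t) {t : ℝ} (ht : a ≤ t) : c ≤ f t := by
  have h := image_le_of_deriv_right_lt_deriv_boundary' (f := fun _ => c) (f' := fun _ => 0)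
    (B := f) (B' := f') (a := a) (b := t) continuousOn_const
    (fun x _ => hasDerivWithinAt_const _ _ _) ha
    (fun x _ => (hf x).continuousAt.continuousWithinAt)
    (fun x _ => (hf x).hasDerivWithinAt) (fun x hx hxc => hlevel x hx.1 hxc.symm)
  exact h ⟨ht, le_rfl⟩

/-- A level that a differentiable function can only cross downwards remains above it. -/
theorem le_of_hasDerivAt_neg_on_level {f f' : ℝ → ℝ} {a c : ℝ}
    (hf : ∀ t, HasDerivAt f (f' t) t) (ha : f a ≤ c)
    (hlevel : ∀ t, a ≤ t → f t = c → f' t < 0) {t : ℝ} (ht : a ≤ t) : f t ≤ c := by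
  have h := le_of_hasDerivAt_pos_on_level (f := fun t => -f t) (f' := fun t => -f' t) (c := -c)
    (fun t => (hf t).neg) (neg_le_neg ha)
    (fun t hat htc => neg_pos.2 (hlevel t hat (neg_injective htc))) ht
  exact neg_le_neg_iff.1 h

/-! ### The Prüfer equation -/

/-- The right-hand side of the Prüfer equation `θ' = p cos² θ + g sin² θ` of the system
`u' = p v`, `v' = -g u`, where `u = r sin θ` and `v = r cos θ`. -/
noncomputable def prueferField (p g : ℝ → ℝ) (t x : ℝ) : ℝ :=
  p t * Real.cos x ^ 2 + g t * Real.sin x ^ 2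

/-- `θ` is the Prüfer angle of the solution with `v 0 = 0`, that is, with `θ 0 = π / 2`. -/
structure IsPrueferAngle (p g θ : ℝ → ℝ) : Prop where
  initial : θ 0 = Real.pi / 2
  hasDerivAt : ∀ t, HasDerivAt θ (prueferField p g t (θ t)) t

theorem IsPrueferAngle.continuous {p g θ : ℝ → ℝ} (h : IsPrueferAngle p g θ) : Continuous θ :=
  continuous_iff_continuousAt.2 fun t => (h.hasDerivAt t).continuousAt

theorem abs_sin_sq_sub_sin_sq_le (x y : ℝ) :
    |Real.sin x ^ 2 - Real.sin y ^ 2| ≤ 2 * |x - y| := by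
  have h1 : |Real.sin x - Real.sin y| ≤ |x - y| := by
    have := Real.lipschitzWith_sin.dist_le_mul x y
    simpa [Real.dist_eq] using this
  have h2 : |Real.sin x + Real.sin y| ≤ 2 := by
    refine (abs_add_le _ _).trans ?_
    linarith [Real.abs_sin_le_one x, Real.abs_sin_le_one y]
  rw [sq_sub_sq, abs_mul]
  exact mul_le_mul h2 h1 (abs_nonneg _) (by norm_num)

theorem lipschitzWith_prueferField {p g : ℝ → ℝ} {P G : ℝ} (hp : ∀ t, |p t| ≤ P)
    (hg : ∀ t, |g t| ≤ G) (t : ℝ) :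
    LipschitzWith (2 * (P + G)).toNNReal (prueferField p g t) := by
  have hPG : 0 ≤ P + G := by linarith [(abs_nonneg _).trans (hp 0), (abs_nonneg _).trans (hg 0)]
  refine LipschitzWith.of_dist_le_mul fun x y => ?_
  rw [Real.coe_toNNReal _ (by positivity), Real.dist_eq, Real.dist_eq]
  have hsub : prueferField p g t x - prueferField p g t y =
      (g t - p t) * (Real.sin x ^ 2 - Real.sin y ^ 2) := by
    simp only [prueferField, Real.cos_sq']; ring
  have hgp : |g t - p t| ≤ P + G := by
    have := abs_sub (g t) (p t)
    linarith [hp t, hg t]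
  rw [hsub, abs_mul]
  calc |g t - p t| * |Real.sin x ^ 2 - Real.sin y ^ 2|
      ≤ (P + G) * (2 * |x - y|) :=
        mul_le_mul hgp (abs_sin_sq_sub_sin_sq_le x y) (abs_nonneg _) hPG
    _ = 2 * (P + G) * |x - y| := by ring

theorem exists_isPrueferAngle {p g : ℝ → ℝ} {P G : ℝ} (hpc : Continuous p) (hgc : Continuous g)
    (hp : ∀ t, |p t| ≤ P) (hg : ∀ t, |g t| ≤ G) : ∃ θ, IsPrueferAngle p g θ := by
  obtain ⟨θ, h0, hθ⟩ := exists_global_solution (B := P + G) (lipschitzWith_prueferField hp hg)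
    (fun x => by unfold prueferField; fun_prop)
    (fun t x => by
      have h1 : |p t * Real.cos x ^ 2| ≤ P := by
        rw [abs_mul, abs_of_nonneg (sq_nonneg (Real.cos x))]
        exact (mul_le_of_le_one_right (abs_nonneg _) (Real.cos_sq_le_one x)).trans (hp t)
      have h2 : |g t * Real.sin x ^ 2| ≤ G := by
        rw [abs_mul, abs_of_nonneg (sq_nonneg (Real.sin x))]
        exact (mul_le_of_le_one_right (abs_nonneg _) (Real.sin_sq_le_one x)).trans (hg t)
      exact (abs_add_le _ _).trans (add_le_add h1 h2)) (Real.pi / 2)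
  exact ⟨θ, h0, hθ⟩

/-- Continuous dependence of the Prüfer angle on the coefficient `g`. -/
theorem IsPrueferAngle.dist_le {p g₁ g₂ θ₁ θ₂ : ℝ → ℝ} {P G ε : ℝ}
    (h₁ : IsPrueferAngle p g₁ θ₁) (h₂ : IsPrueferAngle p g₂ θ₂) (hp : ∀ t, |p t| ≤ P)
    (hg : ∀ t, |g₁ t| ≤ G) (hε : ∀ t, |g₂ t - g₁ t| ≤ ε) {t : ℝ} (ht : 0 ≤ t) :
    dist (θ₁ t) (θ₂ t) ≤ gronwallBound 0 (2 * (P + G)).toNNReal ε t := by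
  have h := dist_le_of_approx_trajectories_ODE (a := 0) (b := t) (δ := 0) (εf := 0) (εg := ε)
    (lipschitzWith_prueferField hp hg) h₁.continuous.continuousOn
    (fun s _ => (h₁.hasDerivAt s).hasDerivWithinAt) (fun s _ => (dist_self _).le)
    h₂.continuous.continuousOn (fun s _ => (h₂.hasDerivAt s).hasDerivWithinAt)
    (fun s _ => by
      have : prueferField p g₂ s (θ₂ s) - prueferField p g₁ s (θ₂ s) =
          (g₂ s - g₁ s) * Real.sin (θ₂ s) ^ 2 := by
        simp only [prueferField]; ring
      rw [Real.dist_eq, this, abs_mul, abs_of_nonneg (sq_nonneg (Real.sin _))]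
      exact (mul_le_of_le_one_right (abs_nonneg _) (Real.sin_sq_le_one _)).trans (hε s))
    (by rw [h₁.initial, h₂.initial, dist_self]) t ⟨ht, le_rfl⟩
  simpa using h

theorem prueferField_of_sin_eq_zero {p g : ℝ → ℝ} {t x : ℝ} (hx : Real.sin x = 0) :
    prueferField p g t x = p t := by
  simp [prueferField, Real.cos_sq', hx]

theorem prueferField_of_cos_eq_zero {p g : ℝ → ℝ} {t x : ℝ} (hx : Real.cos x = 0) :
    prueferField p g t x = g t := by
  simp [prueferField, Real.sin_sq, hx]

theorem cos_nat_mul_pi_sub_pi_div_two (n : ℕ) :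
    Real.cos (n * Real.pi - Real.pi / 2) = 0 := by
  rw [Real.cos_sub_pi_div_two, Real.sin_nat_mul_pi]

/-- Once the angle has reached a multiple of `π`, where it always increases, it stays beyond. -/
theorem IsPrueferAngle.nat_mul_pi_le {p g θ : ℝ → ℝ} (h : IsPrueferAngle p g θ)
    (hp : ∀ t, 0 < p t) (n : ℕ) {a t : ℝ} (ha : n * Real.pi ≤ θ a) (hat : a ≤ t) :
    n * Real.pi ≤ θ t :=
  le_of_hasDerivAt_pos_on_level h.hasDerivAt ha
    (fun s _ hs => by
      rw [prueferField_of_sin_eq_zero (by rw [hs, Real.sin_nat_mul_pi])]; exact hp s) hat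

/-- Where `g` is negative the angle decreases at odd multiples of `π / 2`, and cannot climb
beyond them. -/
theorem IsPrueferAngle.le_nat_mul_pi_sub {p g θ : ℝ → ℝ} (h : IsPrueferAngle p g θ) {a : ℝ}
    (hg : ∀ t, a ≤ t → g t < 0) (n : ℕ) {t : ℝ} (ha : θ a ≤ n * Real.pi - Real.pi / 2)
    (hat : a ≤ t) : θ t ≤ n * Real.pi - Real.pi / 2 :=
  le_of_hasDerivAt_neg_on_level h.hasDerivAt ha
    (fun s hs hc => by
      rw [prueferField_of_cos_eq_zero (by rw [hc, cos_nat_mul_pi_sub_pi_div_two])]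
      exact hg s hs) hat

/-! ### Fast rotation for large coefficients -/

/-- For large `A`, the time that `θ' = m cos² θ + A sin² θ` takes to travel any fixed distance
is small. -/
theorem tendsto_integral_inv_cos_sq_add_sin_sq {m : ℝ} (hm : 0 < m) (b : ℝ) :
    Tendsto (fun A : ℝ => ∫ x in (0 : ℝ)..b, (m * Real.cos x ^ 2 + A * Real.sin x ^ 2)⁻¹)
      atTop (𝓝 0) := by
  have hlow : ∀ A : ℝ, m ≤ A → ∀ x : ℝ, m ≤ m * Real.cos x ^ 2 + A * Real.sin x ^ 2 := by
    intro A hA x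
    nlinarith [Real.sin_sq_add_cos_sq x, sq_nonneg (Real.sin x)]
  have hzero : ∀ᵐ x : ℝ, Real.sin x ≠ 0 := by
    have hc : {x : ℝ | Real.sin x = 0}.Countable := by
      refine (countable_range fun n : ℤ => (n : ℝ) * Real.pi).mono fun x hx => ?_
      obtain ⟨n, hn⟩ := Real.sin_eq_zero_iff.1 hx
      exact ⟨n, hn⟩
    exact hc.ae_notMem volume
  have h := intervalIntegral.tendsto_integral_filter_of_dominated_convergence (μ := volume)
    (a := 0) (b := b) (l := atTop)
    (F := fun A x => (m * Real.cos x ^ 2 + A * Real.sin x ^ 2)⁻¹) (f := fun _ => (0 : ℝ))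
    (fun _ => m⁻¹) (Eventually.of_forall fun A => by fun_prop)
    (by
      filter_upwards [eventually_ge_atTop m] with A hA
      refine Eventually.of_forall fun x _ => ?_
      have := hlow A hA x
      rw [norm_inv, Real.norm_of_nonneg (hm.le.trans this)]
      exact inv_anti₀ hm this)
    intervalIntegrable_const
    (by
      filter_upwards [hzero] with x hx _
      have hx2 : 0 < Real.sin x ^ 2 := by positivity
      exact (tendsto_atTop_add_const_left _ _
        (tendsto_id.atTop_mul_const hx2)).inv_tendsto_atTop)
  simpa using h

/-- If `p ≥ m > 0` on `[c, d]`, then the angle passes any prescribed level before `d` as soon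
as `g` is large enough on `[c, d]`. -/
theorem exists_forall_isPrueferAngle_gt {m c d : ℝ} (hm : 0 < m) (hcd : c < d) (b : ℝ) :
    ∃ A₀ : ℝ, ∀ p g θ : ℝ → ℝ, IsPrueferAngle p g θ → (∀ t ∈ Ioo c d, m ≤ p t) →
      (∀ t ∈ Ioo c d, A₀ ≤ g t) → 0 ≤ θ c → b < θ d := by
  obtain ⟨A, hA, hAm⟩ := (((tendsto_integral_inv_cos_sq_add_sin_sq hm b).eventually_lt_const
    (sub_pos.2 hcd)).and (eventually_ge_atTop m)).exists
  refine ⟨A, fun p g θ hθ hp hg h0 => ?_⟩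
  by_contra! hb
  have hlow : ∀ x : ℝ, 0 < m * Real.cos x ^ 2 + A * Real.sin x ^ 2 := fun x => by
    nlinarith [Real.sin_sq_add_cos_sq x, sq_nonneg (Real.sin x)]
  set f : ℝ → ℝ := fun x => (m * Real.cos x ^ 2 + A * Real.sin x ^ 2)⁻¹ with hf
  have hfc : Continuous f := by
    refine Continuous.inv₀ (by fun_prop) fun x => (hlow x).ne'
  have hfi : ∀ x y, IntervalIntegrable f volume x y := fun x y => hfc.intervalIntegrable x y
  -- The passage time `Φ` grows along the angle at least as fast as time itself.
  set Φ : ℝ → ℝ := fun y => ∫ x in (0 : ℝ)..y, f x with hΦ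
  have hΦd : ∀ t, HasDerivAt (fun s => Φ (θ s)) (f (θ t) * prueferField p g t (θ t)) t :=
    fun t => (intervalIntegral.integral_hasDerivAt_right (hfi _ _)
      (hfc.stronglyMeasurableAtFilter _ _) hfc.continuousAt).comp t (hθ.hasDerivAt t)
  have hmono : MonotoneOn (fun s => Φ (θ s) - s) (Icc c d) := by
    refine monotoneOn_of_deriv_nonneg (convex_Icc c d)
      (fun t _ => ((hΦd t).sub (hasDerivAt_id t)).continuousAt.continuousWithinAt)
      (fun t _ => ((hΦd t).sub (hasDerivAt_id t)).differentiableAt.differentiableWithinAt)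
      fun t ht => ?_
    rw [interior_Icc] at ht
    have hd := ((hΦd t).sub (hasDerivAt_id t)).deriv
    change deriv (fun s => Φ (θ s) - s) t = _ at hd
    rw [hd, sub_nonneg, hf]
    rw [inv_mul_eq_div, one_le_div (hlow _)]
    exact add_le_add (mul_le_mul_of_nonneg_right (hp t ht) (sq_nonneg _))
      (mul_le_mul_of_nonneg_right (hg t ht) (sq_nonneg _))
  have hΦmono : Monotone Φ := by
    intro x y hxy
    have hsplit := intervalIntegral.integral_add_adjacent_intervals (hfi 0 x) (hfi x y)
    have : 0 ≤ ∫ s in x..y, f s :=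
      intervalIntegral.integral_nonneg hxy fun s _ => (inv_pos.2 (hlow s)).le
    simp only [hΦ]
    linarith
  have h1 : Φ (θ c) - c ≤ Φ (θ d) - d :=
    hmono ⟨le_rfl, hcd.le⟩ ⟨hcd.le, le_rfl⟩ hcd.le
  have h2 : 0 ≤ Φ (θ c) := by simpa [hΦ] using hΦmono h0
  have h3 : Φ (θ d) ≤ Φ b := hΦmono hb
  have h4 : Φ b < d - c := hA
  linarith

/-! ### From angles to decaying solutions -/

/-- The amplitude of the solution with Prüfer angle `θ`, from `r' = r (p - g) sin θ cos θ`. -/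
noncomputable def prueferAmplitude (p g θ : ℝ → ℝ) (t : ℝ) : ℝ :=
  Real.exp (∫ s in (0 : ℝ)..t, (p s - g s) * Real.sin (θ s) * Real.cos (θ s))

section Amplitude

variable {p g θ : ℝ → ℝ}

theorem prueferAmplitude_pos (t : ℝ) : 0 < prueferAmplitude p g θ t := Real.exp_pos _

theorem IsPrueferAngle.hasDerivAt_amplitude (h : IsPrueferAngle p g θ) (hp : Continuous p)
    (hg : Continuous g) (t : ℝ) :
    HasDerivAt (prueferAmplitude p g θ)
      (prueferAmplitude p g θ t * ((p t - g t) * Real.sin (θ t) * Real.cos (θ t))) t := by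
  have hθ := h.continuous
  have hc : Continuous fun s => (p s - g s) * Real.sin (θ s) * Real.cos (θ s) := by fun_prop
  exact (intervalIntegral.integral_hasDerivAt_right (hc.intervalIntegrable _ _)
    (hc.stronglyMeasurableAtFilter _ _) hc.continuousAt).exp

theorem IsPrueferAngle.hasDerivAt_mul_sin (h : IsPrueferAngle p g θ) (hp : Continuous p)
    (hg : Continuous g) (t : ℝ) :
    HasDerivAt (fun s => prueferAmplitude p g θ s * Real.sin (θ s))
      (p t * (prueferAmplitude p g θ t * Real.cos (θ t))) t := by
  refine ((h.hasDerivAt_amplitude hp hg t).mul (h.hasDerivAt t).sin).congr_deriv ?_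
  simp only [prueferField, Real.cos_sq']
  ring

theorem IsPrueferAngle.hasDerivAt_mul_cos (h : IsPrueferAngle p g θ) (hp : Continuous p)
    (hg : Continuous g) (t : ℝ) :
    HasDerivAt (fun s => prueferAmplitude p g θ s * Real.cos (θ s))
      (-(g t * (prueferAmplitude p g θ t * Real.sin (θ t)))) t := by
  refine ((h.hasDerivAt_amplitude hp hg t).mul (h.hasDerivAt t).cos).congr_deriv ?_
  simp only [prueferField, Real.sin_sq]
  ring

end Amplitude

/-- If `w' = -p z`, `z' = g w` with `w, z ≥ 0`, `p > 0` and `g ≤ -q < 0` near infinity, then `w`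
decreases and is integrable, so it tends to zero. -/
theorem tendsto_zero_of_nonneg_system {p g w z : ℝ → ℝ} {Y q : ℝ} (hq : 0 < q)
    (hp : ∀ t, 0 < p t) (hg : ∀ t, Y ≤ t → g t ≤ -q)
    (hw : ∀ t, HasDerivAt w (-(p t * z t)) t) (hz : ∀ t, HasDerivAt z (g t * w t) t)
    (hw0 : ∀ t, Y ≤ t → 0 ≤ w t) (hz0 : ∀ t, Y ≤ t → 0 ≤ z t) :
    Tendsto w atTop (𝓝 0) := by
  have hanti : AntitoneOn w (Ici Y) := by
    refine antitoneOn_of_deriv_nonpos (convex_Ici Y)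
      (fun t _ => (hw t).continuousAt.continuousWithinAt)
      (fun t _ => (hw t).differentiableAt.differentiableWithinAt) fun t ht => ?_
    rw [interior_Ici] at ht
    rw [(hw t).deriv]
    exact neg_nonpos.2 (mul_nonneg (hp t).le (hz0 t (le_of_lt ht)))
  have hle : ∀ T, Y < T → w T ≤ z Y / (q * (T - Y)) := by
    intro T hT
    have hd : ∀ s, HasDerivAt (fun s => z s + q * w T * (s - Y)) (g s * w s + q * w T) s := by
      intro s
      have h1 := ((hasDerivAt_id s).sub_const Y).const_mul (q * w T)
      rw [mul_one] at h1
      exact (hz s).add h1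
    have hA : AntitoneOn (fun s => z s + q * w T * (s - Y)) (Icc Y T) := by
      refine antitoneOn_of_deriv_nonpos (convex_Icc Y T)
        (fun t _ => (hd t).continuousAt.continuousWithinAt)
        (fun t _ => (hd t).differentiableAt.differentiableWithinAt) fun t ht => ?_
      rw [interior_Icc] at ht
      rw [(hd t).deriv]
      have h1 : w T ≤ w t := hanti ht.1.le hT.le ht.2.le
      have h2 := mul_le_mul_of_nonneg_right (hg t ht.1.le) (hw0 t ht.1.le)
      nlinarith
    have h := hA ⟨le_rfl, hT.le⟩ ⟨hT.le, le_rfl⟩ hT.le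
    have hzT := hz0 T hT.le
    simp only [sub_self, mul_zero, add_zero] at h
    rw [le_div_iff₀ (mul_pos hq (sub_pos.2 hT))]
    linarith
  have hlim : Tendsto (fun T => z Y / (q * (T - Y))) atTop (𝓝 0) :=
    ((tendsto_atTop_add_const_right atTop (-Y) tendsto_id).const_mul_atTop hq).const_div_atTop _
  exact tendsto_of_tendsto_of_tendsto_of_le_of_le' tendsto_const_nhds hlim
    (by filter_upwards [eventually_ge_atTop Y] with t ht using hw0 t ht)
    (by filter_upwards [eventually_gt_atTop Y] with t ht using hle t ht)

/-- If the angle is trapped in a sector where `u` and `v` have opposite signs, then `u` decays. -/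
theorem IsPrueferAngle.tendsto_mul_sin {p g θ : ℝ → ℝ} (h : IsPrueferAngle p g θ)
    (hpc : Continuous p) (hgc : Continuous g) (hp : ∀ t, 0 < p t) {Y q : ℝ} (hq : 0 < q)
    (hg : ∀ t, Y ≤ t → g t ≤ -q) (n : ℕ)
    (hθ : ∀ t, Y ≤ t → θ t ∈ Icc (n * Real.pi - Real.pi / 2) (n * Real.pi)) :
    Tendsto (fun t => prueferAmplitude p g θ t * Real.sin (θ t)) atTop (𝓝 0) := by
  have hsq : ((-1 : ℝ) ^ n) * (-1) ^ n = 1 := by rw [← mul_pow]; simp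
  -- The signs that make both components nonnegative in the `n`-th sector.
  set w : ℝ → ℝ := fun t => -(-1) ^ n * (prueferAmplitude p g θ t * Real.sin (θ t)) with hw
  set z : ℝ → ℝ := fun t => (-1) ^ n * (prueferAmplitude p g θ t * Real.cos (θ t)) with hz
  have hsector : ∀ t, Y ≤ t → 0 ≤ -(-1) ^ n * Real.sin (θ t) ∧ 0 ≤ (-1) ^ n * Real.cos (θ t) := by
    intro t ht
    obtain ⟨h1, h2⟩ := hθ t ht
    have hs : -(-1) ^ n * Real.sin (θ t) = Real.sin (n * Real.pi - θ t) := by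
      rw [Real.sin_nat_mul_pi_sub]; ring
    have hc : (-1) ^ n * Real.cos (θ t) = Real.cos (n * Real.pi - θ t) := by
      rw [Real.cos_nat_mul_pi_sub]
    rw [hs, hc]
    exact ⟨Real.sin_nonneg_of_nonneg_of_le_pi (by linarith) (by linarith [Real.pi_pos]),
      Real.cos_nonneg_of_neg_pi_div_two_le_of_le (by linarith [Real.pi_pos]) (by linarith)⟩
  have hlim : Tendsto w atTop (𝓝 0) := by
    refine tendsto_zero_of_nonneg_system (z := z) hq hp hg (fun t => ?_) (fun t => ?_)
      (fun t ht => ?_) (fun t ht => ?_)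
    · refine ((h.hasDerivAt_mul_sin hpc hgc t).const_mul (-(-1) ^ n)).congr_deriv ?_
      simp only [hz]; ring
    · refine ((h.hasDerivAt_mul_cos hpc hgc t).const_mul ((-1) ^ n)).congr_deriv ?_
      simp only [hw]; ring
    · have := mul_nonneg (prueferAmplitude_pos (p := p) (g := g) (θ := θ) t).le (hsector t ht).1
      simp only [hw]; linarith
    · have := mul_nonneg (prueferAmplitude_pos (p := p) (g := g) (θ := θ) t).le (hsector t ht).2
      simp only [hz]; linarith
  have h2 := hlim.const_mul (-(-1 : ℝ) ^ n)
  rw [mul_zero] at h2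
  refine h2.congr fun t => ?_
  simp only [hw]
  linear_combination (prueferAmplitude p g θ t * Real.sin (θ t)) * hsq

/-! ### Shooting in the spectral parameter -/

/-- A continuous, positive and bounded medium on the whole line, with `μ` bounded away from `0`. -/
structure IsBoundedMedium (ρ μ : ℝ → ℝ) : Prop where
  continuous_rho : Continuous ρ
  continuous_mu : Continuous μ
  rho_pos : ∀ t, 0 < ρ t
  mu_pos : ∀ t, 0 < μ t
  rho_bdd : ∃ R, ∀ t, |ρ t| ≤ R
  mu_bdd : ∃ M, ∀ t, |μ t| ≤ M
  inv_mu_bdd : ∃ P, ∀ t, |(μ t)⁻¹| ≤ P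

/-- For every `Ω`, `θ Ω` is the Prüfer angle of `(μ u')' + (Ω ρ - K μ) u = 0`, `u' 0 = 0`. -/
def IsPrueferFamily (ρ μ : ℝ → ℝ) (K : ℝ) (θ : ℝ → ℝ → ℝ) : Prop :=
  ∀ Ω, IsPrueferAngle (fun t => (μ t)⁻¹) (fun t => Ω * ρ t - K * μ t) (θ Ω)

section Shooting

variable {ρ μ : ℝ → ℝ} {K : ℝ} {θ : ℝ → ℝ → ℝ}

theorem IsBoundedMedium.continuous_inv_mu (h : IsBoundedMedium ρ μ) :
    Continuous fun t => (μ t)⁻¹ :=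
  h.continuous_mu.inv₀ fun t => (h.mu_pos t).ne'

theorem IsBoundedMedium.continuous_potential (h : IsBoundedMedium ρ μ) (K Ω : ℝ) :
    Continuous fun t => Ω * ρ t - K * μ t :=
  (continuous_const.mul h.continuous_rho).sub (continuous_const.mul h.continuous_mu)

theorem IsBoundedMedium.potential_bdd (h : IsBoundedMedium ρ μ) (K Ω : ℝ) :
    ∃ G, ∀ t, |Ω * ρ t - K * μ t| ≤ G := by
  obtain ⟨R, hR⟩ := h.rho_bdd
  obtain ⟨M, hM⟩ := h.mu_bdd
  refine ⟨|Ω| * R + |K| * M, fun t => (abs_sub _ _).trans ?_⟩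
  rw [abs_mul, abs_mul]
  gcongr
  exacts [hR t, hM t]

theorem IsBoundedMedium.exists_isPrueferFamily (h : IsBoundedMedium ρ μ) (K : ℝ) :
    ∃ θ, IsPrueferFamily ρ μ K θ := by
  obtain ⟨P, hP⟩ := h.inv_mu_bdd
  have : ∀ Ω, ∃ θ, IsPrueferAngle (fun t => (μ t)⁻¹) (fun t => Ω * ρ t - K * μ t) θ := fun Ω =>
    let ⟨_, hG⟩ := h.potential_bdd K Ω
    exists_isPrueferAngle h.continuous_inv_mu (h.continuous_potential K Ω) hP hG
  exact ⟨fun Ω => (this Ω).choose, fun Ω => (this Ω).choose_spec⟩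

theorem IsPrueferFamily.continuous_param (hθ : IsPrueferFamily ρ μ K θ)
    (h : IsBoundedMedium ρ μ) {t : ℝ} (ht : 0 ≤ t) : Continuous fun Ω => θ Ω t := by
  obtain ⟨P, hP⟩ := h.inv_mu_bdd
  obtain ⟨R, hR⟩ := h.rho_bdd
  refine continuous_iff_continuousAt.2 fun Ω => ?_
  obtain ⟨G, hG⟩ := h.potential_bdd K Ω
  have hbound : ∀ Ω', dist (θ Ω' t) (θ Ω t) ≤
      gronwallBound 0 (2 * (P + G)).toNNReal (|Ω' - Ω| * R) t := by
    intro Ω'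
    rw [dist_comm]
    refine (hθ Ω).dist_le (hθ Ω') hP hG (fun s => ?_) ht
    have : Ω' * ρ s - K * μ s - (Ω * ρ s - K * μ s) = (Ω' - Ω) * ρ s := by ring
    rw [this, abs_mul]
    exact mul_le_mul_of_nonneg_left (hR s) (abs_nonneg _)
  have hlim : Tendsto (fun Ω' => gronwallBound 0 (2 * (P + G)).toNNReal (|Ω' - Ω| * R) t)
      (𝓝 Ω) (𝓝 0) := by
    have hc : Continuous fun Ω' =>
        gronwallBound 0 (2 * (P + G)).toNNReal (|Ω' - Ω| * R) t :=
      (gronwallBound_continuous_ε 0 _ t).comp (by fun_prop)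
    simpa [gronwallBound_ε0_δ0] using hc.tendsto Ω
  exact tendsto_iff_dist_tendsto_zero.2
    (squeeze_zero (fun _ => dist_nonneg) hbound hlim)

/-- As long as `Ω ρ ≤ K μ` everywhere, the solution does not turn back: its angle stays below
`π / 2`. -/
theorem IsPrueferFamily.le_pi_div_two (hθ : IsPrueferFamily ρ μ K θ) (h : IsBoundedMedium ρ μ)
    {Ω : ℝ} (hΩ : ∀ t, 0 ≤ t → Ω * ρ t ≤ K * μ t) {t : ℝ} (ht : 0 ≤ t) :
    θ Ω t ≤ Real.pi / 2 := by
  -- For smaller parameters the inequality is strict; the claim follows in the limit.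
  have hlt : ∀ Ω' < Ω, θ Ω' t ≤ Real.pi / 2 := by
    intro Ω' hΩ'
    have := (hθ Ω').le_nat_mul_pi_sub (a := 0) (t := t)
      (fun s hs => by
        have := mul_lt_mul_of_pos_right hΩ' (h.rho_pos s)
        linarith [hΩ s hs]) 1
      (by rw [(hθ Ω').initial]; push_cast; linarith) ht
    push_cast at this
    linarith
  have hc : Tendsto (fun Ω' => θ Ω' t) (𝓝[<] Ω) (𝓝 (θ Ω t)) :=
    ((hθ.continuous_param h ht).tendsto Ω).mono_left nhdsWithin_le_nhds
  exact le_of_tendsto hc (by filter_upwards [self_mem_nhdsWithin] with Ω' hΩ' using hlt Ω' hΩ')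

/-- Shooting: if at `Ω = Ωs` the angle passes `n π`, and `Ωs ρ - K μ < 0` near infinity, then at
the infimum of the parameters for which it passes `n π` the angle is trapped in the sector
`[n π - π / 2, n π]`: passing `n π`, or leaving the sector downwards, would be stable under small
changes of `Ω`. -/
theorem IsPrueferFamily.exists_trapped (hθ : IsPrueferFamily ρ μ K θ) (h : IsBoundedMedium ρ μ)
    (hK : 0 ≤ K) {Ωs Y T : ℝ} (hΩs : 0 ≤ Ωs) (hY : 0 ≤ Y) (hT : 0 ≤ T)
    (hg : ∀ t, Y ≤ t → Ωs * ρ t - K * μ t < 0) {n : ℕ} (hn : 1 ≤ n)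
    (hpass : n * Real.pi < θ Ωs T) :
    ∃ Ω < Ωs, ∀ t, Y ≤ t → θ Ω t ∈ Icc (n * Real.pi - Real.pi / 2) (n * Real.pi) := by
  set Z : Set ℝ := {Ω | 0 ≤ Ω ∧ ∃ t, 0 ≤ t ∧ n * Real.pi < θ Ω t} with hZ
  have hsZ : Ωs ∈ Z := ⟨hΩs, T, hT, hpass⟩
  have hbdd : BddBelow Z := ⟨0, fun Ω hΩ => hΩ.1⟩
  have hn' : (1 : ℝ) ≤ n := by exact_mod_cast hn
  have hnpi : Real.pi ≤ n * Real.pi := by nlinarith [Real.pi_pos]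
  have h0Z : (0 : ℝ) ∉ Z := by
    rintro ⟨-, t, ht, hlt⟩
    have := hθ.le_pi_div_two h (Ω := 0)
      (fun s _ => by rw [zero_mul]; exact mul_nonneg hK (h.mu_pos s).le) ht
    linarith [Real.pi_pos]
  have hinf0 : 0 ≤ sInf Z := le_csInf ⟨Ωs, hsZ⟩ fun Ω hΩ => hΩ.1
  have hnot : sInf Z ∉ Z := by
    rintro hmem
    obtain ⟨-, t, ht, hlt⟩ := id hmem
    have hpos : 0 < sInf Z := lt_of_le_of_ne hinf0 fun h0 => h0Z (h0 ▸ hmem)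
    have hev : ∀ᶠ Ω in 𝓝[<] (sInf Z), n * Real.pi < θ Ω t ∧ 0 < Ω :=
      nhdsWithin_le_nhds ((((hθ.continuous_param h ht).tendsto _).eventually_const_lt hlt).and
        (lt_mem_nhds hpos))
    obtain ⟨Ω, ⟨h1, h2⟩, h3⟩ := (hev.and self_mem_nhdsWithin).exists
    exact absurd (csInf_le hbdd ⟨h2.le, t, ht, h1⟩) (not_le.2 h3)
  have hlts : sInf Z < Ωs := lt_of_le_of_ne (csInf_le hbdd hsZ) fun he => hnot (he ▸ hsZ)
  refine ⟨sInf Z, hlts, fun t ht => ⟨?_, ?_⟩⟩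
  · by_contra! hlow
    have ht0 : 0 ≤ t := hY.trans ht
    have hev : ∀ᶠ Ω in 𝓝 (sInf Z), θ Ω t < n * Real.pi - Real.pi / 2 ∧ Ω < Ωs :=
      (((hθ.continuous_param h ht0).tendsto _).eventually_lt_const hlow).and (gt_mem_nhds hlts)
    obtain ⟨Ω, ⟨-, t', ht', hlt'⟩, h1, h2⟩ :=
      ((mem_closure_iff_frequently.1 (csInf_mem_closure ⟨Ωs, hsZ⟩ hbdd)).and_eventually hev).exists
    rcases le_total t' t with htt | htt
    · have := (hθ Ω).nat_mul_pi_le (fun s => inv_pos.2 (h.mu_pos s)) n hlt'.le htt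
      linarith [Real.pi_pos]
    · have := (hθ Ω).le_nat_mul_pi_sub (a := t) (fun s hs => by
        have h3 := mul_lt_mul_of_pos_right h2 (h.rho_pos s)
        linarith [hg s (ht.trans hs)]) n h1.le htt
      linarith [Real.pi_pos]
  · by_contra! hhigh
    exact hnot ⟨hinf0, t, hY.trans ht, hhigh⟩

end Shooting

/-! ### The surface wave problem -/

/-- A continuous function that is constant on `(-∞, 0]` and has a limit at `+∞` is bounded. -/
theorem exists_abs_le_of_tendsto {f : ℝ → ℝ} {l : ℝ} (hf : Continuous f)
    (hneg : ∀ t ≤ 0, f t = f 0) (hlim : Tendsto f atTop (𝓝 l)) : ∃ C, ∀ t, |f t| ≤ C := by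
  have hev : ∀ᶠ t in atTop, |f t| < |l| + 1 :=
    hlim.abs.eventually_lt_const (by linarith)
  obtain ⟨Y, hY⟩ := eventually_atTop.1 hev
  obtain ⟨C, hC⟩ := (isCompact_Icc (a := (0 : ℝ)) (b := max Y 0)).exists_bound_of_continuousOn
    hf.continuousOn
  refine ⟨max C (|l| + 1), fun t => ?_⟩
  rcases le_total t 0 with h0 | h0
  · rw [hneg t h0]
    exact (hC 0 ⟨le_rfl, le_max_right _ _⟩).trans (le_max_left _ _)
  · rcases le_total t (max Y 0) with h1 | h1
    · exact (hC t ⟨h0, h1⟩).trans (le_max_left _ _)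
    · exact (hY t ((le_max_left _ _).trans h1)).le.trans (le_max_right _ _)

/-- The extension of a medium from the half-line to the whole line by constants. -/
def extendMedium (f : ℝ → ℝ) (t : ℝ) : ℝ := f (max t 0)

theorem extendMedium_of_nonneg {f : ℝ → ℝ} {t : ℝ} (ht : 0 ≤ t) : extendMedium f t = f t := by
  rw [extendMedium, max_eq_left ht]

theorem extendMedium_of_nonpos {f : ℝ → ℝ} {t : ℝ} (ht : t ≤ 0) :
    extendMedium f t = extendMedium f 0 := by
  rw [extendMedium, extendMedium, max_eq_right ht, max_self]

theorem continuous_extendMedium {f : ℝ → ℝ} (hf : ContinuousOn f (Ici 0)) :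
    Continuous (extendMedium f) :=
  hf.comp_continuous (by fun_prop) fun t => le_max_right t 0

theorem tendsto_extendMedium {f : ℝ → ℝ} {l : ℝ} (hf : Tendsto f atTop (𝓝 l)) :
    Tendsto (extendMedium f) atTop (𝓝 l) :=
  hf.congr' (by
    filter_upwards [eventually_ge_atTop 0] with t ht using (extendMedium_of_nonneg ht).symm)

section Medium

variable {ρ μ : ℝ → ℝ} {ρinf μinf : ℝ}

theorem MediumLipschitz.continuousOn_rho (h : MediumLipschitz ρ μ ρinf μinf) :
    ContinuousOn ρ (Ici 0) :=
  let ⟨_, hC⟩ := h.lipschitz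
  continuous_fst.comp_continuousOn hC.continuousOn

theorem MediumLipschitz.continuousOn_mu (h : MediumLipschitz ρ μ ρinf μinf) :
    ContinuousOn μ (Ici 0) :=
  let ⟨_, hC⟩ := h.lipschitz
  continuous_snd.comp_continuousOn hC.continuousOn

theorem MediumLipschitz.tendsto_rho (h : MediumLipschitz ρ μ ρinf μinf) :
    Tendsto ρ atTop (𝓝 ρinf) :=
  (continuous_fst.tendsto _).comp h.tendsto

theorem MediumLipschitz.tendsto_mu (h : MediumLipschitz ρ μ ρinf μinf) :
    Tendsto μ atTop (𝓝 μinf) :=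
  (continuous_snd.tendsto _).comp h.tendsto

theorem MediumLipschitz.isBoundedMedium (h : MediumLipschitz ρ μ ρinf μinf)
    (hpos : MediumPositive ρ μ) : IsBoundedMedium (extendMedium ρ) (extendMedium μ) := by
  have hρ := continuous_extendMedium h.continuousOn_rho
  have hμ := continuous_extendMedium h.continuousOn_mu
  have hμpos : ∀ t, 0 < extendMedium μ t := fun t => (hpos _ (le_max_right t 0)).2
  have hμlim := tendsto_extendMedium h.tendsto_mu
  refine ⟨hρ, hμ, fun t => (hpos _ (le_max_right t 0)).1, hμpos,
    exists_abs_le_of_tendsto hρ (fun t ht => extendMedium_of_nonpos ht)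
      (tendsto_extendMedium h.tendsto_rho),
    exists_abs_le_of_tendsto hμ (fun t ht => extendMedium_of_nonpos ht) hμlim,
    exists_abs_le_of_tendsto (hμ.inv₀ fun t => (hμpos t).ne') (fun t ht => ?_)
      (hμlim.inv₀ h.mu_pos.ne')⟩
  rw [extendMedium_of_nonpos ht]

/-- A continuous function on the half-line with a value below its limit attains its minimum. -/
theorem exists_isMinOn_Ici_of_lt_lim {f : ℝ → ℝ} {l t₀ : ℝ} (hf : ContinuousOn f (Ici 0))
    (hlim : Tendsto f atTop (𝓝 l)) (ht₀ : 0 ≤ t₀) (hlt : f t₀ < l) :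
    ∃ y ∈ Ici (0 : ℝ), IsMinOn f (Ici 0) y := by
  obtain ⟨Y, hY⟩ := eventually_atTop.1 (hlim.eventually_const_lt hlt)
  obtain ⟨y, hy, hmin⟩ := (isCompact_Icc (a := (0 : ℝ)) (b := max Y t₀)).exists_isMinOn
    ⟨t₀, ht₀, le_max_right _ _⟩ (hf.mono Icc_subset_Ici_self)
  refine ⟨y, hy.1, fun t ht => ?_⟩
  rcases le_total t (max Y t₀) with h | h
  · exact hmin ⟨ht, h⟩
  · exact (hmin ⟨ht₀, le_max_right _ _⟩).trans (hY t ((le_max_left _ _).trans h)).le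

/-- A trapped Prüfer angle of the extended medium gives a surface wave. -/
theorem isSurfaceWave_of_trapped (h : IsBoundedMedium (extendMedium ρ) (extendMedium μ))
    {K Ω Y q : ℝ} {θ : ℝ → ℝ}
    (hθ : IsPrueferAngle (fun t => (extendMedium μ t)⁻¹)
      (fun t => Ω * extendMedium ρ t - K * extendMedium μ t) θ)
    (hq : 0 < q) (hg : ∀ t, Y ≤ t → Ω * extendMedium ρ t - K * extendMedium μ t ≤ -q) {n : ℕ}
    (htrap : ∀ t, Y ≤ t → θ t ∈ Icc (n * Real.pi - Real.pi / 2) (n * Real.pi)) :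
    ∃ u, IsSurfaceWave ρ μ K Ω u := by
  set p : ℝ → ℝ := fun t => (extendMedium μ t)⁻¹ with hp
  set g : ℝ → ℝ := fun t => Ω * extendMedium ρ t - K * extendMedium μ t with hgdef
  set u : ℝ → ℝ := fun t => prueferAmplitude p g θ t * Real.sin (θ t) with hu
  set v : ℝ → ℝ := fun t => prueferAmplitude p g θ t * Real.cos (θ t) with hv
  have hpc : Continuous p := h.continuous_inv_mu
  have hgc : Continuous g := h.continuous_potential K Ω
  have hud : ∀ t, HasDerivAt u (p t * v t) t := hθ.hasDerivAt_mul_sin hpc hgc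
  have hvd : ∀ t, HasDerivAt v (-(g t * u t)) t := hθ.hasDerivAt_mul_cos hpc hgc
  have hderiv : ∀ t ∈ Ici (0 : ℝ), derivWithin u (Ici 0) t = p t * v t := fun t ht =>
    (hud t).hasDerivWithinAt.derivWithin (uniqueDiffOn_Ici 0 t ht)
  have hflux : ∀ t ∈ Ici (0 : ℝ), μ t * derivWithin u (Ici 0) t = v t := by
    intro t ht
    have hμ := (h.mu_pos t).ne'
    rw [hderiv t ht, ← extendMedium_of_nonneg (f := μ) ht, hp]
    field_simp
  refine ⟨u, fun t _ => (hud t).differentiableAt.differentiableWithinAt, fun t ht => ?_, ?_,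
    hθ.tendsto_mul_sin hpc hgc (fun t => inv_pos.2 (h.mu_pos t)) hq hg n htrap,
    0, self_mem_Ici, ?_⟩
  · refine ((hvd t).hasDerivWithinAt.congr hflux (hflux t ht)).congr_deriv ?_
    simp only [hgdef, extendMedium_of_nonneg (mem_Ici.1 ht)]
  · rw [hderiv 0 self_mem_Ici, hv]
    simp [hθ.initial]
  · simp [hu, hθ.initial, (prueferAmplitude_pos (p := p) (g := g) (θ := θ) 0).ne']

/-- If at `Ω = Ωs` the angle passes `(N + 1) π`, then there are `N` surface waves, one for each
sector from the second to the `(N + 1)`-st. Distinct sectors belong to distinct parameters, since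
the angle of one parameter is eventually trapped in at most one sector. -/
theorem exists_finset_surfaceWave (hpos : MediumPositive ρ μ)
    (hlip : MediumLipschitz ρ μ ρinf μinf) {L₁ K Ωs Y q T : ℝ} (hK : 0 < K)
    (hmin : ∀ t, 0 ≤ t → L₁ * ρ t ≤ μ t) (hΩs : 0 ≤ Ωs) (hY : 0 ≤ Y) (hT : 0 ≤ T) (hq : 0 < q)
    (hg : ∀ t, Y ≤ t → Ωs * ρ t - K * μ t ≤ -q) {N : ℕ}
    (hpass : ∀ θ, IsPrueferAngle (fun t => (extendMedium μ t)⁻¹)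
      (fun t => Ωs * extendMedium ρ t - K * extendMedium μ t) θ → (N + 1 : ℕ) * Real.pi < θ T) :
    ∃ S : Finset ℝ, N ≤ S.card ∧
      ∀ Ω ∈ S, Ω ∈ Ioo (L₁ * K) Ωs ∧ ∃ u, IsSurfaceWave ρ μ K Ω u := by
  have hmed := hlip.isBoundedMedium hpos
  obtain ⟨θ, hθ⟩ := hmed.exists_isPrueferFamily K
  have hg' : ∀ t, Y ≤ t → Ωs * extendMedium ρ t - K * extendMedium μ t ≤ -q := by
    intro t ht
    rw [extendMedium_of_nonneg (hY.trans ht), extendMedium_of_nonneg (hY.trans ht)]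
    exact hg t ht
  -- Sectors are numbered from `2`: the first one may be occupied at `Ω = L₁ K` itself.
  have hex : ∀ n ∈ Finset.Icc 2 (N + 1), ∃ Ω < Ωs,
      ∀ t, Y ≤ t → θ Ω t ∈ Icc (n * Real.pi - Real.pi / 2) (n * Real.pi) := by
    intro n hn
    rw [Finset.mem_Icc] at hn
    refine hθ.exists_trapped hmed hK.le hΩs hY hT (fun t ht => by linarith [hg' t ht])
      (by omega) (lt_of_le_of_lt ?_ (hpass _ (hθ Ωs)))
    exact mul_le_mul_of_nonneg_right (by exact_mod_cast hn.2) Real.pi_pos.le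
  choose! Ω hΩlt hΩ using hex
  have hinj : Set.InjOn Ω (Finset.Icc 2 (N + 1) : Finset ℕ) := by
    have key : ∀ m ∈ Finset.Icc 2 (N + 1), ∀ n ∈ Finset.Icc 2 (N + 1), Ω m = Ω n → n ≤ m := by
      intro m hm n hn he
      by_contra! hmn
      have h1 := (hΩ m hm Y le_rfl).2
      have h2 := (hΩ n hn Y le_rfl).1
      rw [he] at h1
      have h3 : (m : ℝ) + 1 ≤ n := by exact_mod_cast hmn
      nlinarith [Real.pi_pos, mul_le_mul_of_nonneg_right h3 Real.pi_pos.le]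
    intro m hm n hn he
    exact le_antisymm (key n hn m hm he.symm) (key m hm n hn he)
  refine ⟨(Finset.Icc 2 (N + 1)).image Ω, ?_, ?_⟩
  · rw [Finset.card_image_of_injOn hinj, Nat.card_Icc]
    omega
  · intro Ω' hΩ'
    obtain ⟨n, hn, rfl⟩ := Finset.mem_image.1 hΩ'
    refine ⟨⟨?_, hΩlt n hn⟩, ?_⟩
    · by_contra! hle
      have h1 := hθ.le_pi_div_two hmed (Ω := Ω n) (fun t ht => by
        rw [extendMedium_of_nonneg ht, extendMedium_of_nonneg ht]
        have h2 := mul_le_mul_of_nonneg_right hle (hpos t ht).1.le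
        have h3 := mul_le_mul_of_nonneg_left (hmin t ht) hK.le
        linarith) hY
      have h2 := (hΩ n hn Y le_rfl).1
      have h3 : (2 : ℝ) ≤ n := by exact_mod_cast (Finset.mem_Icc.1 hn).1
      nlinarith [Real.pi_pos]
    · refine isSurfaceWave_of_trapped hmed (hθ (Ω n)) hq (fun t ht => ?_) (hΩ n hn)
      have h1 := mul_le_mul_of_nonneg_right (hΩlt n hn).le (hmed.rho_pos t).le
      linarith [hg' t ht]

/-- If `μ / ρ` is somewhere below its limit, then for large `K` there are many surface waves with
parameters between `K min (μ / ρ)` and `K lim (μ / ρ)`. -/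
theorem exists_many_surfaceWave (hpos : MediumPositive ρ μ)
    (hlip : MediumLipschitz ρ μ ρinf μinf) {L₁ t₀ : ℝ}
    (hmin : ∀ t, 0 ≤ t → L₁ * ρ t ≤ μ t) (ht₀ : 0 < t₀) (hlt : μ t₀ / ρ t₀ < μinf / ρinf)
    (N : ℕ) :
    ∃ K_N : ℝ, 0 < K_N ∧ ∀ K : ℝ, K_N < K → ∃ S : Finset ℝ, N ≤ S.card ∧
      ∀ Ω ∈ S, Ω ∈ Ioo (L₁ * K) (μinf / ρinf * K) ∧ ∃ u, IsSurfaceWave ρ μ K Ω u := by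
  obtain ⟨a, ha1, ha2⟩ := exists_between hlt
  obtain ⟨b, hb1, hb2⟩ := exists_between ha2
  obtain ⟨e, he1, he2⟩ := exists_between hb2
  have hb0 : 0 < b := by
    have := div_pos (hpos t₀ ht₀.le).2 (hpos t₀ ht₀.le).1
    linarith
  have hmed := hlip.isBoundedMedium hpos
  -- Near infinity `μ / ρ > e > b`, so that `b ρ - μ` is negative there.
  obtain ⟨Y, hY⟩ : ∃ Y, 0 ≤ Y ∧ ∀ t, Y ≤ t → ρinf / 2 < ρ t ∧ e < μ t / ρ t := by
    have hev := (hlip.tendsto_rho.eventually_const_lt (half_lt_self hlip.rho_pos)).and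
      ((hlip.tendsto_mu.div hlip.tendsto_rho hlip.rho_pos.ne').eventually_const_lt he2)
    obtain ⟨Y, hY⟩ := eventually_atTop.1 hev
    exact ⟨max Y 0, le_max_right _ _, fun t ht => hY t ((le_max_left _ _).trans ht)⟩
  -- On a neighbourhood of `t₀`, `μ / ρ < a < b`, so that `b ρ - μ` is positive there.
  obtain ⟨c, d, hc0, hcd, hnear⟩ : ∃ c d, 0 ≤ c ∧ c < d ∧ ∀ t ∈ Ioo c d,
      ρ t₀ / 2 < ρ t ∧ μ t / ρ t < a ∧ μ t < μ t₀ + 1 := by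
    have hnhds : Ici (0 : ℝ) ∈ 𝓝 t₀ := Ici_mem_nhds ht₀
    have hρ := hlip.continuousOn_rho.continuousAt hnhds
    have hμ := hlip.continuousOn_mu.continuousAt hnhds
    have hρ0 := (hpos t₀ ht₀.le).1
    have hev := (hρ.tendsto.eventually_const_lt (half_lt_self hρ0)).and
      (((hμ.div hρ hρ0.ne').tendsto.eventually_lt_const ha1).and
        ((hμ.tendsto.eventually_lt_const (lt_add_one _)).and (lt_mem_nhds ht₀)))
    obtain ⟨c, d, ⟨h1, h2⟩, hsub⟩ := mem_nhds_iff_exists_Ioo_subset.1 hev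
    refine ⟨max c 0, d, le_max_right _ _, max_lt (h1.trans h2) (ht₀.trans h2), fun t ht => ?_⟩
    have := hsub ⟨(le_max_left _ _).trans_lt ht.1, ht.2⟩
    exact ⟨this.1, this.2.1, this.2.2.1⟩
  have hρ0 := (hpos t₀ ht₀.le).1
  have hμ0 := (hpos t₀ ht₀.le).2
  have hm : 0 < (μ t₀ + 1)⁻¹ := by positivity
  obtain ⟨A, hA⟩ := exists_forall_isPrueferAngle_gt hm hcd ((N + 1 : ℕ) * Real.pi)
  set η : ℝ := ρ t₀ / 2 * (b - a) with hη
  have hη0 : 0 < η := mul_pos (half_pos hρ0) (sub_pos.2 hb1)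
  refine ⟨max 1 (A / η), by positivity, fun K hK => ?_⟩
  have hK0 : 0 < K := one_pos.trans ((le_max_left _ _).trans_lt hK)
  have hKA : A < K * η := (div_lt_iff₀ hη0).1 ((le_max_right _ _).trans_lt hK)
  obtain ⟨S, hS, hS'⟩ := exists_finset_surfaceWave hpos hlip (L₁ := L₁) (K := K) (Ωs := b * K)
    (Y := Y) (q := K * (ρinf / 2 * (e - b))) (T := d) (N := N) hK0 hmin (by positivity) hY.1
    (hc0.trans hcd.le)
    (mul_pos hK0 (mul_pos (half_pos hlip.rho_pos) (sub_pos.2 he1)))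
    (fun t ht => by
      obtain ⟨h1, h2⟩ := hY.2 t ht
      have hρt := (hpos t (hY.1.trans ht)).1
      rw [lt_div_iff₀ hρt] at h2
      have h3 := mul_le_mul_of_nonneg_right h1.le (sub_pos.2 he1).le
      have h4 : b * ρ t - μ t ≤ -(ρinf / 2 * (e - b)) := by linarith
      have h5 := mul_le_mul_of_nonneg_left h4 hK0.le
      linarith)
    (fun θ hθ => by
      refine hA _ _ θ hθ (fun t ht => ?_) (fun t ht => ?_) ?_
      · have ht0 : 0 ≤ t := hc0.trans ht.1.le
        rw [extendMedium_of_nonneg ht0]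
        exact inv_anti₀ (hpos t ht0).2 (hnear t ht).2.2.le
      · have ht0 : 0 ≤ t := hc0.trans ht.1.le
        rw [extendMedium_of_nonneg ht0, extendMedium_of_nonneg ht0]
        obtain ⟨h1, h2, -⟩ := hnear t ht
        rw [div_lt_iff₀ (hpos t ht0).1] at h2
        have h3 := mul_le_mul_of_nonneg_right h1.le (sub_pos.2 hb1).le
        have h4 : η ≤ b * ρ t - μ t := by rw [hη]; linarith
        have h5 := mul_le_mul_of_nonneg_left h4 hK0.le
        linarith
      · have := hθ.nat_mul_pi_le (fun s => inv_pos.2 (hmed.mu_pos s)) 0 (a := 0) (t := c)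
          (by rw [hθ.initial]; push_cast; linarith [Real.pi_pos]) hc0
        simpa using this)
  exact ⟨S, hS, fun Ω hΩ => ⟨⟨(hS' Ω hΩ).1.1,
    (hS' Ω hΩ).1.2.trans (mul_lt_mul_of_pos_right hb2 hK0)⟩, (hS' Ω hΩ).2⟩⟩

/-- Passing from the parameters `Ω = ω ^ 2` to the frequencies `ω`. -/
theorem natCast_le_surfaceWaveCount {k : ℝ} {N : ℕ} {S : Finset ℝ} (hN : N ≤ S.card)
    (hS : ∀ Ω ∈ S, 0 < Ω ∧ ∃ u, IsSurfaceWave ρ μ (k ^ 2) Ω u) :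
    (N : ℕ∞) ≤ surfaceWaveCount ρ μ k := by
  have hinj : Set.InjOn Real.sqrt (S : Set ℝ) := fun x hx y hy h =>
    (Real.sqrt_inj (hS x hx).1.le (hS y hy).1.le).1 h
  have hcard : (S.image Real.sqrt).card = S.card := Finset.card_image_of_injOn hinj
  have hsub : ((S.image Real.sqrt : Finset ℝ) : Set ℝ) ⊆
      {ω : ℝ | 0 < ω ∧ ∃ u : ℝ → ℝ, IsSurfaceWave ρ μ (k ^ 2) (ω ^ 2) u} := by
    intro ω hω
    obtain ⟨Ω, hΩ, rfl⟩ := Finset.mem_image.1 (Finset.mem_coe.1 hω)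
    obtain ⟨h0, hu⟩ := hS Ω hΩ
    refine ⟨Real.sqrt_pos.2 h0, ?_⟩
    rwa [Real.sq_sqrt h0.le]
  have h := Set.encard_mono hsub
  rw [Set.encard_coe_eq_coe_finsetCard, hcard] at h
  exact (Nat.cast_le.2 hN).trans h

end Medium

theorem theorem2 (ρ μ : ℝ → ℝ) (ρinf μinf : ℝ)
    (hpos : MediumPositive ρ μ)
    (hlip : MediumLipschitz ρ μ ρinf μinf)
    (hint : MediumIntegrable ρ μ ρinf μinf)
    (hmon : MediumMonotoneAtInfinity ρ μ ρinf μinf)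
    (hsub : ∃ c d : ℝ, 0 ≤ c ∧ c < d ∧
      ∀ y ∈ Ioo c d, polarArg (ρ y) (μ y) < polarArg ρinf μinf) :
    (∃ ymin ∈ Ici (0 : ℝ), IsMinOn (fun y => μ y / ρ y) (Ici 0) ymin ∧
      ∀ N : ℕ, ∃ K_N : ℝ, 0 < K_N ∧ ∀ K : ℝ, K_N < K →
        ∃ S : Finset ℝ, N ≤ S.card ∧
          ∀ Ω ∈ S, Ω ∈ Ioo (μ ymin / ρ ymin * K) (μinf / ρinf * K) ∧
            ∃ u : ℝ → ℝ, IsSurfaceWave ρ μ K Ω u) ∧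
    Tendsto (surfaceWaveCount ρ μ) atTop (𝓝 ⊤) := by
  obtain ⟨c, d, hc, hcd, harg⟩ := hsub
  obtain ⟨t₀, hct, htd⟩ := exists_between hcd
  have ht₀ : 0 < t₀ := hc.trans_lt hct
  have hlt : μ t₀ / ρ t₀ < μinf / ρinf := Real.arctan_strictMono.lt_iff_lt.1 (harg t₀ ⟨hct, htd⟩)
  obtain ⟨ymin, hy, hmin⟩ := exists_isMinOn_Ici_of_lt_lim (f := fun y => μ y / ρ y)
    (hlip.continuousOn_mu.div hlip.continuousOn_rho fun t ht => (hpos t ht).1.ne')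
    (hlip.tendsto_mu.div hlip.tendsto_rho hlip.rho_pos.ne') ht₀.le hlt
  have hmany := exists_many_surfaceWave hpos hlip (L₁ := μ ymin / ρ ymin)
    (fun t ht => (le_div_iff₀ (hpos t ht).1).1 (hmin ht)) ht₀ hlt
  refine ⟨⟨ymin, hy, hmin, hmany⟩, ENat.tendsto_nhds_top_iff_natCast_lt.2 fun N => ?_⟩
  obtain ⟨K_N, -, hK⟩ := hmany (N + 1)
  filter_upwards [eventually_gt_atTop K_N, eventually_ge_atTop 1] with k hk hk1
  have hk2 : K_N < k ^ 2 := by nlinarith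
  obtain ⟨S, hS, hS'⟩ := hK (k ^ 2) hk2
  have hlow : 0 < μ ymin / ρ ymin * k ^ 2 :=
    mul_pos (div_pos (hpos ymin hy).2 (hpos ymin hy).1) (by positivity)
  refine lt_of_lt_of_le ?_ (natCast_le_surfaceWaveCount hS fun Ω hΩ =>
    ⟨hlow.trans (hS' Ω hΩ).1.1, (hS' Ω hΩ).2⟩)
  exact_mod_cast Nat.lt_succ_self N
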